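/- For $2\le n\le\infty$ let $\mathcal O_n$ be the Cuntz algebra, that is, the unital C$^*$-algebra universally generated by $s_1,\dots,s_n$ (by $s_1,s_2,\dots$ if $n=\infty$) subject to $s_i^*s_j=\delta_{ij}I$, together with $\sum_{i=1}^n s_is_i^*=I$ if $n<\infty$, and $\sum_{i=1}^k s_is_i^*\le I$ for all $k\ge1$ if $n=\infty$. For a state $\omega$ on $\mathcal O_n$ with GNS representation $(\mathcal H,\pi,\Omega)$, let $\mathcal K(\omega)\subset\mathcal H$ be the closed linear span of the vectors $\pi(s_J)^*\Omega$, where $J=(j_1,\dots,j_l)$ runs over all finite words in the indices, $s_J=s_{j_1}\cdots s_{j_l}$ and $s_\emptyset=I$. Put $\operatorname{cdim}\omega=\dim\mathcal K(\omega)\in\{1,2,\dots,\infty\}$ and $\kappa(\omega)=\min\{\operatorname{cdim}\omega' : \omega'\sim\omega\}$, where $\omega'\sim\omega$ means that the GNS representations of $\omega'$ and $\omega$ are unitarily equivalent. The state $\omega$ is called finitely correlated if $\operatorname{cdim}\omega<\infty$, and essentially finitely correlated if $\kappa(\omega)<\infty$. Proposition. For every $2\le n\le\infty$ there is a state on $\mathcal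 O_n$ which is essentially finitely correlated but not finitely correlated. Explicitly, there is a unique state $\omega$ on $\mathcal O_n$ with $\omega(s_1)=1$ (a Cuntz state). With $A_l=s_2^{\,l-1}s_1s_2^{\,l}$ for $l\ge1$, the series $A=\sum_{l\ge1}2^{-l/2}A_l$ converges in norm in $\mathcal O_n$, the functional $\omega'(x)=\omega(A^*xA)$ is a state on $\mathcal O_n$, and $\kappa(\omega')=1$ and $\operatorname{cdim}\omega'=\infty$. -/

import Mathlib

open scoped ENNReal ComplexOrder InnerProductSpace

universe u

namespace Cuntz

noncomputable section

/-! ### The Cuntz algebra -/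

/-- The index set `{1, …, n}` of the generators; it is `{1, 2, 3, …}` when `n = ⊤` (that is, `∞`). -/
def Index (n : ℕ∞) : Type := {j : ℕ // 1 ≤ j ∧ (j : ℕ∞) ≤ n}

/-- The index `1`. -/
def Index.one {n : ℕ∞} (hn : 2 ≤ n) : Index n :=
  ⟨1, le_rfl, by simpa using le_trans one_le_two hn⟩

/-- The index `2`. -/
def Index.two {n : ℕ∞} (hn : 2 ≤ n) : Index n :=
  ⟨2, one_le_two, by simpa using hn⟩

/-- The defining relations of the Cuntz algebra, for a family in a unital C⋆-algebra. -/
structure IsCuntzFamily (n : ℕ∞) {B : Type*} [CStarAlgebra B] (t : Index n → B) : Prop where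
  star_mul_self : ∀ i, star (t i) * t i = 1
  star_mul_of_ne : ∀ i j, i ≠ j → star (t i) * t j = 0
  /-- The sum of all range projections is `1` when `n` is finite: then exactly one finset `F`
  contains all the indices, while there is none when `n = ⊤`. -/
  sum_eq_one : ∀ F : Finset (Index n), (∀ i, i ∈ F) → ∑ i ∈ F, t i * star (t i) = 1
  /-- Finite sums of range projections are at most `1` (the condition for `n = ⊤`; for finite `n`
  it follows from the previous one). -/
  sum_le_one : ∀ F : Finset (Index n),
    (CStarAlgebra.spectralOrder B).le (∑ i ∈ F, t i * star (t i)) 1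

/-- The inequality in `IsCuntzFamily` is automatic, because the range projections are mutually
orthogonal. -/
theorem IsCuntzFamily.of_eq {n : ℕ∞} {B : Type*} [CStarAlgebra B] {t : Index n → B}
    (h1 : ∀ i, star (t i) * t i = 1) (h2 : ∀ i j, i ≠ j → star (t i) * t j = 0)
    (h3 : ∀ F : Finset (Index n), (∀ i, i ∈ F) → ∑ i ∈ F, t i * star (t i) = 1) :
    IsCuntzFamily n t where
  star_mul_self := h1
  star_mul_of_ne := h2
  sum_eq_one := h3
  sum_le_one F := by
    classical
    let _ := CStarAlgebra.spectralOrder B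
    have _ := CStarAlgebra.spectralOrderedRing B
    change ∑ i ∈ F, t i * star (t i) ≤ 1
    have hsa : star (∑ i ∈ F, t i * star (t i)) = ∑ i ∈ F, t i * star (t i) := by
      simp [star_sum]
    have hterm : ∀ i j, t i * star (t i) * (t j * star (t j)) =
        if i = j then t i * star (t i) else 0 := by
      intro i j
      have e : t i * star (t i) * (t j * star (t j)) = t i * (star (t i) * t j) * star (t j) := by
        simp only [mul_assoc]
      rw [e]
      split_ifs with hij
      · subst hij; rw [h1, mul_one]
      · rw [h2 i j hij, mul_zero, zero_mul]
    have hid : (∑ i ∈ F, t i * star (t i)) * (∑ i ∈ F, t i * star (t i)) =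
        ∑ i ∈ F, t i * star (t i) := by
      rw [Finset.sum_mul_sum]
      refine Finset.sum_congr rfl fun i hi => ?_
      simp [hterm, hi]
    rw [← sub_nonneg]
    have hp : 1 - ∑ i ∈ F, t i * star (t i) =
        star (1 - ∑ i ∈ F, t i * star (t i)) * (1 - ∑ i ∈ F, t i * star (t i)) := by
      rw [star_sub, star_one, hsa, mul_sub, sub_mul, sub_mul, hid]
      simp
    rw [hp]
    exact star_mul_self_nonneg _

/-- A Cuntz family in some nonzero unital C⋆-algebra. -/
structure Model (n : ℕ∞) : Type (u + 1) where
  carrier : Type u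
  [cstar : CStarAlgebra carrier]
  [nontrivial : Nontrivial carrier]
  gen : Index n → carrier
  isCuntzFamily : IsCuntzFamily n gen

attribute [instance] Model.cstar Model.nontrivial

/-- The C⋆-algebra of bounded families with one entry in each model. -/
abbrev ProductAlgebra (n : ℕ∞) : Type (u + 1) := lp (fun M : Model.{u} n => M.carrier) ∞

instance (n : ℕ∞) : CStarAlgebra (ProductAlgebra.{u} n) where

/-- A generator of a Cuntz family is an isometry. -/
theorem Model.norm_gen {n : ℕ∞} (M : Model.{u} n) (i : Index n) : ‖M.gen i‖ = 1 := by
  have h := CStarRing.norm_star_mul_self (x := M.gen i)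
  rw [M.isCuntzFamily.star_mul_self, norm_one] at h
  nlinarith [norm_nonneg (M.gen i)]

/-- The family whose entry in each model is the `i`-th generator of that model. -/
def productGen (n : ℕ∞) (i : Index n) : ProductAlgebra.{u} n :=
  ⟨fun M => M.gen i, memℓp_infty ⟨1, by rintro _ ⟨M, rfl⟩; exact (M.norm_gen i).le⟩⟩

/-- The closed unital ⋆-subalgebra of the product generated by the `productGen n i`. -/
def universalSubalgebra (n : ℕ∞) : StarSubalgebra ℂ (ProductAlgebra.{u} n) :=
  (StarAlgebra.adjoin ℂ (Set.range (productGen.{u} n))).topologicalClosure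

instance (n : ℕ∞) : IsClosed (universalSubalgebra.{u} n : Set (ProductAlgebra.{u} n)) :=
  StarSubalgebra.isClosed_topologicalClosure _

end

end Cuntz

/-- The Cuntz algebra `𝓞ₙ`, `n ∈ {2, 3, …, ∞}`: the unital C⋆-algebra universally generated by
`n` elements subject to the Cuntz relations. -/
def CuntzAlgebra (n : ℕ∞) : Type (u + 1) := Cuntz.universalSubalgebra.{u} n

namespace CuntzAlgebra

noncomputable section

open Cuntz

instance (n : ℕ∞) : CStarAlgebra (CuntzAlgebra.{u} n) :=
  inferInstanceAs (CStarAlgebra (universalSubalgebra.{u} n))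

instance (n : ℕ∞) : PartialOrder (CuntzAlgebra.{u} n) := CStarAlgebra.spectralOrder _

instance (n : ℕ∞) : StarOrderedRing (CuntzAlgebra.{u} n) := CStarAlgebra.spectralOrderedRing _

/-- The Cuntz generators `s₁, s₂, …` of `𝓞ₙ`. -/
def s (n : ℕ∞) (i : Index n) : CuntzAlgebra.{u} n :=
  ⟨productGen n i, StarSubalgebra.le_topologicalClosure _
    (StarAlgebra.subset_adjoin ℂ _ ⟨i, rfl⟩)⟩

/-- The inclusion of `𝓞ₙ` into the product of all models. -/
def toProduct (n : ℕ∞) : CuntzAlgebra.{u} n →⋆ₐ[ℂ] ProductAlgebra.{u} n :=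
  (universalSubalgebra.{u} n).subtype

/-- Evaluation of elements of `𝓞ₙ` in a model. -/
def eval {n : ℕ∞} (M : Model.{u} n) : CuntzAlgebra.{u} n →⋆ₐ[ℂ] M.carrier where
  toFun x := toProduct n x M
  map_one' := rfl
  map_mul' _ _ := rfl
  map_zero' := rfl
  map_add' _ _ := rfl
  commutes' _ := rfl
  map_star' _ := rfl

theorem ext_eval {n : ℕ∞} {x y : CuntzAlgebra.{u} n}
    (h : ∀ M : Model.{u} n, eval M x = eval M y) : x = y :=
  Subtype.ext (lp.ext (funext h))

theorem eval_s {n : ℕ∞} (M : Model.{u} n) (i : Index n) : eval M (s n i) = M.gen i := rfl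

theorem eval_star {n : ℕ∞} (M : Model.{u} n) (x : CuntzAlgebra.{u} n) :
    eval M (star x) = star (eval M x) := rfl

/-- The generators satisfy the Cuntz relations. -/
theorem isCuntzFamily_s (n : ℕ∞) : IsCuntzFamily n (s.{u} n) := by
  refine IsCuntzFamily.of_eq (fun i => ext_eval fun M => ?_)
    (fun i j hij => ext_eval fun M => ?_) (fun F hF => ext_eval fun M => ?_)
  · simpa [eval_s, eval_star] using M.isCuntzFamily.star_mul_self i
  · simpa [eval_s, eval_star] using M.isCuntzFamily.star_mul_of_ne i j hij
  · simpa [eval_s, eval_star] using M.isCuntzFamily.sum_eq_one F hF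

/-- The generators generate `𝓞ₙ` as a C⋆-algebra. -/
theorem topologicalClosure_adjoin_s (n : ℕ∞) :
    (StarAlgebra.adjoin ℂ (Set.range (s.{u} n))).topologicalClosure = ⊤ := by
  have himg : (StarAlgebra.adjoin ℂ (Set.range (s.{u} n))).map (toProduct n) =
      StarAlgebra.adjoin ℂ (Set.range (productGen.{u} n)) := by
    rw [StarAlgHom.map_adjoin, ← Set.range_comp]
    rfl
  rw [eq_top_iff]
  rintro x -
  change x ∈ closure (StarAlgebra.adjoin ℂ (Set.range (s.{u} n)) : Set (CuntzAlgebra.{u} n))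
  have hind : Topology.IsInducing (toProduct.{u} n) := Topology.IsInducing.subtypeVal
  rw [hind.closure_eq_preimage_closure_image, ← StarSubalgebra.coe_map, himg]
  exact x.2

/-- The universal property of `𝓞ₙ`. -/
theorem existsUnique_lift (n : ℕ∞) {B : Type u} [CStarAlgebra B] (t : Index n → B)
    (ht : IsCuntzFamily n t) :
    ∃! φ : CuntzAlgebra.{u} n →⋆ₐ[ℂ] B, ∀ i, φ (s n i) = t i := by
  refine existsUnique_of_exists_of_unique ?_ fun φ ψ hφ hψ => ?_
  · rcases subsingleton_or_nontrivial B with hB | hB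
    · exact ⟨{ toFun := fun _ => 0
               map_one' := Subsingleton.elim _ _
               map_mul' := fun _ _ => Subsingleton.elim _ _
               map_zero' := Subsingleton.elim _ _
               map_add' := fun _ _ => Subsingleton.elim _ _
               commutes' := fun _ => Subsingleton.elim _ _
               map_star' := fun _ => Subsingleton.elim _ _ }, fun _ => Subsingleton.elim _ _⟩
    · exact ⟨eval ⟨B, t, ht⟩, fun i => rfl⟩
  · have hle : (StarAlgebra.adjoin ℂ (Set.range (s.{u} n))).topologicalClosure ≤
        StarAlgHom.equalizer φ ψ := by
      refine StarSubalgebra.topologicalClosure_minimal (StarAlgebra.adjoin_le ?_) ?_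
      · rintro _ ⟨i, rfl⟩
        exact (hφ i).trans (hψ i).symm
      · have hc : ∀ χ : CuntzAlgebra.{u} n →⋆ₐ[ℂ] B, Continuous χ := fun χ =>
          AddMonoidHomClass.continuous_of_bound χ 1 fun x => by
            simpa only [one_mul] using NonUnitalStarAlgHom.norm_apply_le χ x
        exact isClosed_eq (hc φ) (hc ψ)
    rw [topologicalClosure_adjoin_s] at hle
    exact StarAlgHom.ext fun x => hle trivial

end

end CuntzAlgebra

/-! ### States, GNS representations, and the two invariants -/

namespace Cuntz

noncomputable section

/-- The states of a unital C⋆-algebra: positive linear functionals with value `1` at the unit. -/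
def State (A : Type*) [CStarAlgebra A] [PartialOrder A] [StarOrderedRing A] :=
  {f : A →ₚ[ℂ] ℂ // f 1 = 1}

section GNS

variable {A : Type*} [CStarAlgebra A] [PartialOrder A] [StarOrderedRing A]

instance : CoeFun (State A) (fun _ => A → ℂ) := ⟨fun ω => ω.1⟩

/-- The Hilbert space `𝓗` of the GNS representation `(𝓗, π, Ω)` of `ω`. -/
abbrev State.H (ω : State A) := ω.1.GNS

/-- The homomorphism `π` of the GNS representation `(𝓗, π, Ω)` of `ω`. -/
def State.π (ω : State A) : A →⋆ₐ[ℂ] (ω.H →L[ℂ] ω.H) := ω.1.gnsStarAlgHom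

/-- The cyclic vector `Ω` of the GNS representation `(𝓗, π, Ω)` of `ω`: the class of `1`. -/
def State.Ω (ω : State A) : ω.H := ((ω.1.toPreGNS 1 : ω.1.PreGNS) : ω.1.GNS)

/-- `ω ∼ ω'`: the GNS representations are unitarily equivalent. -/
def State.Equivalent (ω ω' : State A) : Prop :=
  ∃ U : ω.H ≃ₗᵢ[ℂ] ω'.H, ∀ (a : A) (v : ω.H), U (ω.π a v) = ω'.π a (U v)

end GNS

variable {n : ℕ∞}

/-- The product `s_J = s_{j₁} ⋯ s_{j_l}` for a word `J = (j₁, …, j_l)`, with `s_∅ = 1`. -/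
def word (J : List (Index n)) : CuntzAlgebra.{u} n := (J.map (CuntzAlgebra.s n)).prod

/-- `𝓚(ω)`: the closed linear span of the vectors `π(s_J)* Ω`, over all finite words `J`. -/
def correlationSpace (ω : State (CuntzAlgebra.{u} n)) : Submodule ℂ ω.H :=
  (Submodule.span ℂ
    (Set.range fun J : List (Index n) => star (ω.π (word J)) ω.Ω)).topologicalClosure

/-- `cdim ω = dim 𝓚(ω) ∈ {0, 1, 2, …, ∞}`, all infinite cardinals being identified with `∞`. -/
def cdim (ω : State (CuntzAlgebra.{u} n)) : ℕ∞ :=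
  Cardinal.toENat (Module.rank ℂ (correlationSpace ω))

/-- `κ(ω)`: the least value of `cdim` on the equivalence class of `ω`. -/
def kappa (ω : State (CuntzAlgebra.{u} n)) : ℕ∞ :=
  sInf {d | ∃ ω' : State (CuntzAlgebra.{u} n), ω'.Equivalent ω ∧ cdim ω' = d}

/-- `ω` is finitely correlated if `cdim ω` is not infinite. -/
def IsFinitelyCorrelated (ω : State (CuntzAlgebra.{u} n)) : Prop := cdim ω ≠ ⊤

/-- `ω` is essentially finitely correlated if `κ(ω)` is not infinite. -/
def IsEssentiallyFinitelyCorrelated (ω : State (CuntzAlgebra.{u} n)) : Prop := kappa ω ≠ ⊤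

/-- The element `A_l = s₂^(l-1) s₁ s₂^l`; it is used for `l ≥ 1`. -/
def elementA (hn : 2 ≤ n) (l : ℕ) : CuntzAlgebra.{u} n :=
  CuntzAlgebra.s n (Index.two hn) ^ (l - 1) * CuntzAlgebra.s n (Index.one hn) *
    CuntzAlgebra.s n (Index.two hn) ^ l

end

end Cuntz

/-! A Cuntz state is a vector state whose vector is fixed by `s₁`. It exists because a bijection
`{1, …, n} × ℕ ≃ ℕ` makes `𝓞ₙ` act on `ℓ²(ℕ)` by shifting basis vectors, and the bijection can be
chosen so that `s₁` fixes one of them. Conversely `ω(s₁) = 1` forces `π(s₁)Ω = Ω` (`vec_s_eq`). Then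
`π(s₁)*Ω = Ω` and `π(s_j)*Ω = 0` for `j ≠ 1`, so `ω` is determined on the monomials `s_I s_J*`,
whose span is dense, and `𝓚(ω) = ℂΩ`.

Write `A_l = s_{J_l} s₂^l` with `J_l = (2, …, 2, 1)` of length `l`. No `J_l` is a prefix of another,
so the `s_{J_l}` have orthogonal ranges and `s_{J_l}* A = 2^(-l/2) s₂^l`
(`star_word_prefixWord_mul`). Since `∑ 2^(-l) = 1`, this gives `A*A = 1`. Hence `ω'` is a state, and
`π(A)Ω` is again cyclic, so `ω' ∼ ω` (`State.conj_equivalent`) and `κ(ω') = 1`. But `𝓚(ω')` contains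
nonzero multiples of all `π(s₂^l)Ω`, which are mutually orthogonal because `π(s₂)*Ω = 0`; so `cdim
ω' = ∞`. -/

namespace Cuntz

noncomputable section

/-! ### Vectors and vector states in the GNS representation. -/

section GNS

variable {A : Type*} [CStarAlgebra A] [PartialOrder A] [StarOrderedRing A]

theorem State.ext {ω ω' : State A} (h : ∀ x, ω x = ω' x) : ω = ω' :=
  Subtype.ext (PositiveLinearMap.ext h)

/-- The class of `x` in the GNS space, that is, the vector `π(x) Ω`. -/
def State.vec (ω : State A) : A →ₗ[ℂ] ω.H :=
  (UniformSpace.Completion.toComplₗᵢ (𝕜 := ℂ) (E := ω.1.PreGNS)).toLinearMap ∘ₗ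
    ω.1.toPreGNS.toLinearMap

theorem State.vec_one (ω : State A) : ω.vec 1 = ω.Ω := rfl

theorem State.inner_vec (ω : State A) (x y : A) : ⟪ω.vec x, ω.vec y⟫_ℂ = ω (star x * y) :=
  UniformSpace.Completion.inner_coe _ _

theorem State.π_vec (ω : State A) (a x : A) : ω.π a (ω.vec x) = ω.vec (a * x) :=
  ω.1.gnsNonUnitalStarAlgHom_apply_coe

theorem State.star_π_Ω (ω : State A) (a : A) : star (ω.π a) ω.Ω = ω.vec (star a) := by
  rw [← map_star, ← State.vec_one, State.π_vec, mul_one]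

theorem State.denseRange_vec (ω : State A) : DenseRange ω.vec :=
  UniformSpace.Completion.denseRange_coe.comp ω.1.toPreGNS.surjective.denseRange
    (UniformSpace.Completion.continuous_coe _)

theorem State.apply_eq_inner (ω : State A) (x : A) : ω x = ⟪ω.vec 1, ω.vec x⟫_ℂ := by
  rw [State.inner_vec, star_one, one_mul]

theorem State.apply_star (ω : State A) (x : A) : ω (star x) = star (ω x) :=
  map_star ω.1 x

theorem State.continuous (ω : State A) : Continuous ω := map_continuous ω.1

/-- The GNS null space is a left ideal, so identities between vectors propagate under left
multiplication. -/
theorem State.vec_mul_congr (ω : State A) {x y : A} (h : ω.vec x = ω.vec y) (a : A) :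
    ω.vec (a * x) = ω.vec (a * y) := by
  rw [← State.π_vec, h, State.π_vec]

theorem State.vec_one_ne_zero (ω : State A) : ω.vec 1 ≠ 0 := by
  intro h
  have := ω.apply_eq_inner 1
  rw [h, inner_zero_left, show ω 1 = 1 from ω.2] at this
  exact one_ne_zero this

/-- The state `x ↦ ω(a⋆ x a)`, for an element `a` with `ω(a⋆ a) = 1`. -/
def State.conj (ω : State A) (a : A) (h : ω (star a * a) = 1) : State A :=
  ⟨PositiveLinearMap.mk₀
    (ω.1.toLinearMap ∘ₗ LinearMap.mulRight ℂ a ∘ₗ LinearMap.mulLeft ℂ (star a)) fun x hx =>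
      ω.1.map_nonneg (star_left_conjugate_nonneg hx a), by
    change ω (star a * 1 * a) = 1
    rw [mul_one, h]⟩

theorem State.conj_apply (ω : State A) (a : A) (h : ω (star a * a) = 1) (x : A) :
    ω.conj a h x = ω (star a * x * a) := rfl

/-- If `a` has a left inverse, then `π(a) Ω` is cyclic, so its vector state is equivalent
to `ω`. -/
theorem State.conj_equivalent (ω : State A) (a b : A) (h : ω (star a * a) = 1) (hb : b * a = 1) :
    (ω.conj a h).Equivalent ω := by
  have hd : DenseRange (ω.vec ∘ₗ LinearMap.mulRight ℂ a) := by
    refine ω.denseRange_vec.mono ?_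
    rintro _ ⟨x, rfl⟩
    -- The left inverse recovers every `π(x)Ω` as `π(x b) π(a)Ω`.
    exact ⟨x * b, by simp [mul_assoc, hb]⟩
  have hn : ∀ x : A, ‖(ω.vec ∘ₗ LinearMap.mulRight ℂ a) (LinearEquiv.refl ℂ A x)‖ =
      ‖(ω.conj a h).vec x‖ := by
    intro x
    change ‖ω.vec (x * a)‖ = _
    rw [@norm_eq_sqrt_re_inner ℂ, @norm_eq_sqrt_re_inner ℂ, State.inner_vec, State.inner_vec,
      State.conj_apply, star_mul]
    simp only [mul_assoc]
  -- The unitary extends `vec x ↦ ω.vec (x * a)`, isometric and of dense range.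
  refine ⟨(LinearEquiv.refl ℂ A).extendOfIsometry _ _ (ω.conj a h).denseRange_vec hd hn,
    fun c v => ?_⟩
  refine (ω.conj a h).denseRange_vec.induction_on v ?_ fun x => ?_
  · exact isClosed_eq (by fun_prop) (by fun_prop)
  · rw [State.π_vec, LinearEquiv.extendOfIsometry_eq, LinearEquiv.extendOfIsometry_eq]
    simp [State.π_vec, mul_assoc]

theorem State.Equivalent.symm {ω ω' : State A} (h : ω.Equivalent ω') : ω'.Equivalent ω := by
  obtain ⟨U, hU⟩ := h
  exact ⟨U.symm, fun a v => U.injective (by simp [hU])⟩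

/-- The vector state of a unit vector in a representation. -/
def State.ofVector {H : Type*} [NormedAddCommGroup H] [InnerProductSpace ℂ H] [CompleteSpace H]
    (φ : A →⋆ₐ[ℂ] (H →L[ℂ] H)) (ξ : H) (hξ : ‖ξ‖ = 1) : State A :=
  ⟨PositiveLinearMap.mk₀
    ((innerSL ℂ ξ).toLinearMap ∘ₗ (ContinuousLinearMap.apply ℂ H ξ).toLinearMap ∘ₗ
      φ.toAlgHom.toLinearMap) fun x hx => by
      obtain ⟨y, rfl⟩ := CStarAlgebra.nonneg_iff_eq_star_mul_self.mp hx
      change 0 ≤ ⟪ξ, φ (star y * y) ξ⟫_ℂ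
      rw [map_mul, map_star, mul_apply_eq_comp, ContinuousLinearMap.star_eq_adjoint,
        ContinuousLinearMap.adjoint_inner_right]
      rw [inner_self_eq_norm_sq_to_K]
      exact pow_nonneg (Complex.zero_le_real.mpr (norm_nonneg (φ y ξ))) 2, by
    change ⟪ξ, φ 1 ξ⟫_ℂ = 1
    simp [hξ]⟩

theorem State.ofVector_apply {H : Type*} [NormedAddCommGroup H] [InnerProductSpace ℂ H]
    [CompleteSpace H] (φ : A →⋆ₐ[ℂ] (H →L[ℂ] H)) (ξ : H) (hξ : ‖ξ‖ = 1) (x : A) :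
    State.ofVector φ ξ hξ x = ⟪ξ, φ x ξ⟫_ℂ := rfl

end GNS

/-! ### Permutative representations on `ℓ²(ℕ)` and existence of Cuntz states. -/

/-- The Hilbert space `ℓ²(ℕ)`, in the universe `u`. -/
abbrev EllTwo : Type u := lp (fun _ : ULift.{u} ℕ => ℂ) 2

/-- The standard basis vectors of `ℓ²(ℕ)`. -/
def EllTwo.basis (k : ULift.{u} ℕ) : EllTwo.{u} := lp.single 2 k 1

theorem EllTwo.orthonormal_basis : Orthonormal ℂ EllTwo.basis.{u} := by
  classical
  rw [orthonormal_iff_ite]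
  intro i j
  rw [EllTwo.basis, EllTwo.basis, lp.inner_single_left, lp.single_apply]
  simp [Pi.single_apply]

theorem EllTwo.ext_inner_basis {v w : EllTwo.{u}}
    (h : ∀ k, ⟪EllTwo.basis k, v⟫_ℂ = ⟪EllTwo.basis k, w⟫_ℂ) : v = w := by
  ext k
  simpa [EllTwo.basis, lp.inner_single_left] using h k

theorem EllTwo.ext_basis {S T : EllTwo.{u} →L[ℂ] EllTwo.{u}}
    (h : ∀ k, S (EllTwo.basis k) = T (EllTwo.basis k)) : S = T := by
  refine lp.ext_continuousLinearMap (by simp) fun k => ?_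
  ext
  exact congrArg (fun v : EllTwo.{u} => v _) (h k)

/-- The isometry of `ℓ²(ℕ)` which permutes the basis vectors by an injective map. -/
def EllTwo.shift (f : ULift.{u} ℕ ↪ ULift.{u} ℕ) : EllTwo.{u} →ₗᵢ[ℂ] EllTwo.{u} :=
  (EllTwo.orthonormal_basis.comp f f.injective).orthogonalFamily.linearIsometry

theorem EllTwo.shift_basis (f : ULift.{u} ℕ ↪ ULift.{u} ℕ) (k : ULift.{u} ℕ) :
    EllTwo.shift f (EllTwo.basis k) = EllTwo.basis (f k) := by
  rw [EllTwo.shift, EllTwo.basis, OrthogonalFamily.linearIsometry_apply_single]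
  simp

/-- A bijection `{1, …, n} × ℕ ≃ ℕ` gives a Cuntz family on `ℓ²(ℕ)`. -/
theorem isCuntzFamily_shift {n : ℕ∞} (e : Index n × ULift.{u} ℕ ≃ ULift.{u} ℕ) :
    IsCuntzFamily n fun i => (EllTwo.shift ⟨fun k => e (i, k), fun _ _ h =>
      (Prod.ext_iff.mp (e.injective h)).2⟩).toContinuousLinearMap := by
  classical
  set t : Index n → EllTwo.{u} →L[ℂ] EllTwo.{u} := fun i => (EllTwo.shift ⟨fun k => e (i, k),
    fun _ _ h => (Prod.ext_iff.mp (e.injective h)).2⟩).toContinuousLinearMap with ht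
  have happ : ∀ i k, t i (EllTwo.basis k) = EllTwo.basis (e (i, k)) := fun i k =>
    EllTwo.shift_basis _ k
  have hstar : ∀ i j k, star (t i) (EllTwo.basis (e (j, k))) =
      if i = j then EllTwo.basis k else 0 := by
    intro i j k
    refine EllTwo.ext_inner_basis fun l => ?_
    rw [ContinuousLinearMap.star_eq_adjoint, ContinuousLinearMap.adjoint_inner_right, happ,
      orthonormal_iff_ite.mp EllTwo.orthonormal_basis]
    by_cases hij : i = j
    · simp [hij, orthonormal_iff_ite.mp EllTwo.orthonormal_basis]
    · simp [hij]
  refine IsCuntzFamily.of_eq (fun i => EllTwo.ext_basis fun k => ?_)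
    (fun i j hij => EllTwo.ext_basis fun k => ?_) (fun F hF => EllTwo.ext_basis fun m => ?_)
  · change star (t i) (t i _) = _
    rw [happ, hstar, if_pos rfl, one_apply_eq_self]
  · change star (t i) (t j _) = _
    rw [happ, hstar, if_neg hij, zero_apply]
  -- Each basis vector lies in the range of exactly one isometry, so a single summand acts on it as
  -- the identity.
  · obtain ⟨⟨j, k⟩, rfl⟩ := e.surjective m
    have : ∀ i, (t i * star (t i)) (EllTwo.basis (e (j, k))) =
        if i = j then EllTwo.basis (e (j, k)) else 0 := by
      intro i
      rw [mul_apply_eq_comp, hstar]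
      split_ifs with h
      · rw [happ, h]
      · exact map_zero _
    rw [sum_apply]
    change ∑ i ∈ F, (t i * star (t i)) (EllTwo.basis (e (j, k))) = _
    simp [this, hF]

variable {n : ℕ∞}

instance : Countable (Index n) := inferInstanceAs (Countable (Subtype _))

/-- The fixed point yields a basis vector invariant under the `i`-th isometry. A transposition after
an arbitrary bijection produces it. -/
theorem exists_equiv_apply_eq (i : Index n) (k : ULift.{u} ℕ) :
    ∃ e : Index n × ULift.{u} ℕ ≃ ULift.{u} ℕ, e (i, k) = k := by
  classical
  have : Nonempty (Index n) := ⟨i⟩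
  obtain ⟨e⟩ := nonempty_equiv_of_countable (α := Index n × ULift.{u} ℕ) (β := ULift.{u} ℕ)
  exact ⟨e.trans (Equiv.swap (e (i, k)) k), by simp⟩

/-- There is a Cuntz state for every generator. -/
theorem exists_state_apply_s_eq_one (i : Index n) :
    ∃ ω : State (CuntzAlgebra.{u} n), ω (CuntzAlgebra.s n i) = 1 := by
  obtain ⟨e, he⟩ := exists_equiv_apply_eq.{u} i ⟨0⟩
  -- The universal property takes targets in `Type u`, hence the index set `ULift ℕ`.
  obtain ⟨φ, hφ, -⟩ := CuntzAlgebra.existsUnique_lift n _ (isCuntzFamily_shift e)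
  refine ⟨State.ofVector φ (EllTwo.basis ⟨0⟩) (EllTwo.orthonormal_basis.1 _), ?_⟩
  rw [State.ofVector_apply, hφ]
  change ⟪_, EllTwo.shift _ (EllTwo.basis _)⟫_ℂ = 1
  rw [EllTwo.shift_basis]
  change ⟪_, EllTwo.basis (e (i, _))⟫_ℂ = 1
  rw [he, orthonormal_iff_ite.mp EllTwo.orthonormal_basis, if_pos rfl]

open CuntzAlgebra

theorem star_pow_mul_pow_add {A : Type*} [CStarAlgebra A] {v : A} (hv : star v * v = 1)
    (i k : ℕ) : star (v ^ i) * v ^ (i + k) = v ^ k := by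
  induction i with
  | zero => simp
  | succ i ih =>
    rw [show i + 1 + k = (i + k) + 1 by ring, pow_succ' v i, pow_succ' v (i + k), star_mul,
      mul_assoc, ← mul_assoc (star v), hv, one_mul, ih]

theorem star_pow_mul_pow_self {A : Type*} [CStarAlgebra A] {v : A} (hv : star v * v = 1)
    (i : ℕ) : star (v ^ i) * v ^ i = 1 := by
  simpa using star_pow_mul_pow_add hv i 0

/-! ### Density of the monomials -/

/-- The linear span of the monomials `s_I s_J⋆`. -/
def monomialSpan (n : ℕ∞) : Submodule ℂ (CuntzAlgebra.{u} n) :=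
  Submodule.span ℂ (Set.range fun p : List (Index n) × List (Index n) =>
    word.{u} p.1 * star (word p.2))

theorem word_cons (i : Index n) (J : List (Index n)) : word.{u} (i :: J) = s n i * word J := by
  simp [word]

theorem word_mul_star_word_mem (I J : List (Index n)) :
    word.{u} I * star (word J) ∈ monomialSpan.{u} n :=
  Submodule.subset_span ⟨(I, J), rfl⟩

theorem s_mul_mem_monomialSpan (i : Index n) {x : CuntzAlgebra.{u} n}
    (hx : x ∈ monomialSpan.{u} n) : s n i * x ∈ monomialSpan.{u} n := by
  suffices hle : monomialSpan.{u} n ≤ (monomialSpan.{u} n).comap (LinearMap.mulLeft ℂ (s n i)) from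
    hle hx
  refine Submodule.span_le.mpr ?_
  rintro _ ⟨⟨I, J⟩, rfl⟩
  change s n i * (word I * star (word J)) ∈ monomialSpan n
  rw [← mul_assoc, ← word_cons]
  exact word_mul_star_word_mem _ _

theorem star_s_mul_mem_monomialSpan (i : Index n) {x : CuntzAlgebra.{u} n}
    (hx : x ∈ monomialSpan.{u} n) : star (s n i) * x ∈ monomialSpan.{u} n := by
  suffices hle : monomialSpan.{u} n ≤
      (monomialSpan.{u} n).comap (LinearMap.mulLeft ℂ (star (s n i))) from hle hx
  refine Submodule.span_le.mpr ?_
  rintro _ ⟨⟨I, J⟩, rfl⟩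
  change star (s n i) * (word I * star (word J)) ∈ monomialSpan n
  match I with
  | [] =>
    have := word_mul_star_word_mem.{u} [] (J ++ [i])
    simpa [word] using this
  | j :: I =>
    rw [word_cons, ← mul_assoc, ← mul_assoc]
    by_cases hij : i = j
    · rw [hij, (isCuntzFamily_s n).star_mul_self, one_mul]
      exact word_mul_star_word_mem _ _
    · rw [(isCuntzFamily_s n).star_mul_of_ne i j hij, zero_mul, zero_mul]
      exact zero_mem _

theorem adjoin_subset_monomialSpan {x : CuntzAlgebra.{u} n}
    (hx : x ∈ StarAlgebra.adjoin ℂ (Set.range (s.{u} n))) : x ∈ monomialSpan.{u} n := by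
  -- In this form the induction needs only left multiplication by a generator or its adjoint, not
  -- products of monomials.
  suffices h : ∀ y ∈ monomialSpan.{u} n, x * y ∈ monomialSpan.{u} n by
    simpa [word] using h 1 (by simpa [word] using word_mul_star_word_mem.{u} (n := n) [] [])
  rw [← StarSubalgebra.mem_toSubalgebra, StarAlgebra.adjoin_toSubalgebra] at hx
  induction hx using Algebra.adjoin_induction with
  | mem x hx =>
    intro y hy
    rcases hx with ⟨i, rfl⟩ | ⟨i, hi⟩
    · exact s_mul_mem_monomialSpan i hy
    · rw [← star_star x, ← hi]
      exact star_s_mul_mem_monomialSpan i hy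
  | algebraMap r =>
    intro y hy
    rw [← Algebra.smul_def]
    exact Submodule.smul_mem _ _ hy
  | add a b _ _ ha hb =>
    intro y hy
    rw [add_mul]
    exact add_mem (ha y hy) (hb y hy)
  | mul a b _ _ ha hb =>
    intro y hy
    rw [mul_assoc]
    exact ha _ (hb y hy)

/-- States which agree on all monomials are equal. -/
theorem State.ext_monomial {ω ω' : State (CuntzAlgebra.{u} n)}
    (h : ∀ I J : List (Index n), ω (word I * star (word J)) = ω' (word I * star (word J))) :
    ω = ω' := by
  have hspan : ∀ x ∈ monomialSpan.{u} n, ω x = ω' x := fun x hx =>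
    LinearMap.eqOn_span (f := ω.1.toLinearMap) (g := ω'.1.toLinearMap)
      (by rintro _ ⟨p, rfl⟩; exact h p.1 p.2) hx
  refine State.ext fun x => ?_
  have hx : x ∈ (StarAlgebra.adjoin ℂ (Set.range (s.{u} n))).topologicalClosure := by
    rw [topologicalClosure_adjoin_s]
    trivial
  exact closure_minimal (fun y hy => hspan y (adjoin_subset_monomialSpan hy))
    (isClosed_eq ω.continuous ω'.continuous) hx

/-! ### Cuntz states -/

section CuntzState

variable {ω : State (CuntzAlgebra.{u} n)} {i : Index n}

/-- Equality case of Cauchy–Schwarz: `‖π(s_i)Ω - Ω‖² = 1 - 1 - 1 + 1 = 0`. -/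
theorem vec_s_eq (h : ω (s n i) = 1) : ω.vec (s n i) = ω.vec 1 := by
  rw [← sub_eq_zero, ← map_sub, ← inner_self_eq_zero (𝕜 := ℂ), State.inner_vec]
  have h1 : star (s.{u} n i - 1) * (s n i - 1) = 1 - star (s n i) - s n i + 1 := by
    rw [star_sub, star_one, sub_mul, mul_sub, (isCuntzFamily_s n).star_mul_self]
    simp only [mul_one, one_mul]
    abel
  have h2 : ω (star (s n i)) = 1 := by rw [State.apply_star, h, star_one]
  rw [h1]
  change ω.1 _ = 0
  rw [map_add, map_sub, map_sub]
  change ω 1 - ω (star (s n i)) - ω (s n i) + ω 1 = 0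
  rw [h, h2, show ω 1 = 1 from ω.2]
  ring

theorem vec_star_s_self (h : ω (s n i) = 1) : ω.vec (star (s n i)) = ω.vec 1 := by
  have := ω.vec_mul_congr (vec_s_eq h) (star (s n i))
  rwa [(isCuntzFamily_s n).star_mul_self, mul_one, eq_comm] at this

theorem vec_star_s_of_ne (h : ω (s n i) = 1) {j : Index n} (hj : j ≠ i) :
    ω.vec (star (s n j)) = 0 := by
  have := ω.vec_mul_congr (vec_s_eq h) (star (s n j))
  rwa [(isCuntzFamily_s n).star_mul_of_ne j i hj, mul_one, map_zero, eq_comm] at this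

-- `Ω` is a common eigenvector of all `π(s_j)*`; this gives both uniqueness of `ω` and
-- one-dimensionality of `𝓚(ω)`.
open Classical in
theorem vec_star_word (h : ω (s n i) = 1) (J : List (Index n)) :
    ω.vec (star (word J)) = (if ∀ j ∈ J, j = i then (1 : ℂ) else 0) • ω.vec 1 := by
  induction J with
  | nil => simp [word]
  | cons j J ih =>
    rw [word_cons, star_mul, ← State.π_vec]
    by_cases hj : j = i
    · rw [hj, vec_star_s_self h, State.π_vec, mul_one, ih]
      simp
    · rw [vec_star_s_of_ne h hj, map_zero]
      simp [hj]

theorem State.eq_of_apply_s_eq_one {ω' : State (CuntzAlgebra.{u} n)} (h : ω (s n i) = 1)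
    (h' : ω' (s n i) = 1) : ω = ω' := by
  refine State.ext_monomial fun I J => ?_
  have key : ∀ {φ : State (CuntzAlgebra.{u} n)}, φ (word I * star (word J)) =
      ⟪φ.vec (star (word I)), φ.vec (star (word J))⟫_ℂ := by
    intro φ
    rw [State.inner_vec, star_star]
  have hone : ∀ φ : State (CuntzAlgebra.{u} n), ⟪φ.vec 1, φ.vec 1⟫_ℂ = 1 := fun φ => by
    rw [← State.apply_eq_inner]
    exact φ.2
  rw [key, key, vec_star_word h, vec_star_word h, vec_star_word h', vec_star_word h',
    inner_smul_left, inner_smul_right, inner_smul_left, inner_smul_right, hone, hone]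

/-- For `l < m` the product cancels to a positive power of `s_j`, whose expectation vanishes because
`π(s_j)*Ω = 0`; the other order follows by taking adjoints. -/
theorem apply_star_pow_mul_pow (h : ω (s n i) = 1) {j : Index n} (hj : j ≠ i) {l m : ℕ}
    (hlm : l ≠ m) : ω (star (s n j ^ l) * s n j ^ m) = 0 := by
  have hlt : ∀ {l m : ℕ}, l < m → ω (star (s n j ^ l) * s n j ^ m) = 0 := by
    intro l m hlm
    obtain ⟨k, rfl⟩ := Nat.exists_eq_add_of_lt hlm
    rw [add_assoc, star_pow_mul_pow_add ((isCuntzFamily_s n).star_mul_self j), pow_succ',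
      ← star_star (s n j), ← State.inner_vec, vec_star_s_of_ne h hj, inner_zero_left]
  rcases lt_or_gt_of_ne hlm with hl | hl
  · exact hlt hl
  · have := ω.apply_star (star (s n j ^ m) * s n j ^ l)
    rwa [hlt hl, star_mul, star_star, star_zero] at this

end CuntzState

/-! ### The correlation space -/

theorem vec_star_word_mem (ω : State (CuntzAlgebra.{u} n)) (J : List (Index n)) :
    ω.vec (star (word J)) ∈ correlationSpace ω :=
  Submodule.le_topologicalClosure _
    (Submodule.subset_span ⟨J, State.star_π_Ω ω (word J)⟩)

/-- The empty word contributes `Ω ≠ 0`. -/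
theorem one_le_cdim (ω : State (CuntzAlgebra.{u} n)) : 1 ≤ cdim ω := by
  have hmem : ω.vec 1 ∈ correlationSpace ω := by
    simpa [word] using vec_star_word_mem ω []
  have : Nontrivial (correlationSpace ω) :=
    ⟨⟨⟨_, hmem⟩, 0, fun h => ω.vec_one_ne_zero (congrArg Subtype.val h)⟩⟩
  rw [cdim, Cardinal.one_le_toENat, Cardinal.one_le_iff_pos]
  exact rank_pos

theorem cdim_eq_one {ω : State (CuntzAlgebra.{u} n)} {i : Index n} (h : ω (s n i) = 1) :
    cdim ω = 1 := by
  classical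
  refine le_antisymm ?_ (one_le_cdim ω)
  rw [cdim, Cardinal.toENat_le_one]
  -- A line is already closed, so taking the closure adds nothing.
  have hle : correlationSpace ω ≤ Submodule.span ℂ {ω.vec 1} := by
    refine Submodule.topologicalClosure_minimal _ (Submodule.span_le.mpr ?_)
      (Submodule.closed_of_finiteDimensional _)
    rintro _ ⟨J, rfl⟩
    change star (ω.π (word J)) ω.Ω ∈ _
    rw [State.star_π_Ω, vec_star_word h]
    exact Submodule.smul_mem _ _ (Submodule.mem_span_singleton_self _)
  refine (Submodule.rank_mono hle).trans ((rank_span_le _).trans ?_)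
  simp

/-- Infinitely many mutually orthogonal nonzero vectors `π(s_J)⋆ Ω` force `cdim ω = ∞`. -/
theorem cdim_eq_top {ι : Type*} [Infinite ι] {ω : State (CuntzAlgebra.{u} n)}
    (J : ι → List (Index n)) (hne : ∀ l, ω (word (J l) * star (word (J l))) ≠ 0)
    (horth : ∀ l m, l ≠ m → ω (word (J l) * star (word (J m))) = 0) : cdim ω = ⊤ := by
  have hlin : LinearIndependent ℂ fun l => ω.vec (star (word (J l))) := by
    refine linearIndependent_of_ne_zero_of_inner_eq_zero (fun l h0 => hne l ?_)
      fun l m hlm => ?_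
    · have := ω.inner_vec (star (word (J l))) (star (word (J l)))
      rwa [star_star, h0, inner_zero_left, eq_comm] at this
    · change ⟪ω.vec _, ω.vec _⟫_ℂ = 0
      rw [State.inner_vec, star_star, horth l m hlm]
  have hlin' : LinearIndependent ℂ
      fun l => (⟨_, vec_star_word_mem ω (J l)⟩ : correlationSpace ω) :=
    LinearIndependent.of_comp (correlationSpace ω).subtype hlin
  rw [cdim, Cardinal.toENat_eq_top]
  exact hlin'.aleph0_le_rank

theorem kappa_eq_one {ω ω' : State (CuntzAlgebra.{u} n)} {i : Index n} (h : ω (s n i) = 1)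
    (hω : ω.Equivalent ω') : kappa ω' = 1 := by
  refine le_antisymm (sInf_le ⟨ω, hω, cdim_eq_one h⟩) (le_sInf ?_)
  rintro _ ⟨φ, -, rfl⟩
  exact one_le_cdim φ

/-! ### The isometry `A` and the correlations of `ω'`. -/

variable (hn : 2 ≤ n)

theorem Index.two_ne_one : Index.two hn ≠ Index.one hn := fun h =>
  absurd (congrArg Subtype.val h) (by simp [Index.one, Index.two])

/-- The word `(2, …, 2, 1)` of length `l`, for `l ≥ 1`. -/
def prefixWord (l : ℕ) : List (Index n) :=
  List.replicate (l - 1) (Index.two hn) ++ [Index.one hn]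

theorem word_prefixWord (l : ℕ) :
    word.{u} (prefixWord hn l) = s n (Index.two hn) ^ (l - 1) * s n (Index.one hn) := by
  simp [word, prefixWord]

theorem elementA_eq (l : ℕ) :
    elementA.{u} hn l = word (prefixWord hn l) * s n (Index.two hn) ^ l := by
  rw [word_prefixWord, elementA]

theorem star_word_prefixWord_mul_self (l : ℕ) :
    star (word.{u} (prefixWord hn l)) * word (prefixWord hn l) = 1 := by
  rw [word_prefixWord, star_mul, mul_assoc, ← mul_assoc (star (_ ^ _)),
    star_pow_mul_pow_self ((isCuntzFamily_s n).star_mul_self _), one_mul,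
    (isCuntzFamily_s n).star_mul_self]

/-- For `l < m` the words first differ at position `l`, with letters `1` and `2`; after cancelling
the common prefix, `s₁* s₂ = 0` remains. -/
theorem star_word_prefixWord_mul_of_ne {l m : ℕ+} (hlm : l ≠ m) :
    star (word.{u} (prefixWord hn l)) * word (prefixWord hn m) = 0 := by
  have hlt : ∀ {l m : ℕ+}, l < m →
      star (word.{u} (prefixWord hn l)) * word (prefixWord hn m) = 0 := by
    intro l m hlm
    have hlm' : (l : ℕ) < m := hlm
    have hl := l.pos
    obtain ⟨k, hk⟩ : ∃ k, (m : ℕ) - 1 = (l - 1) + (k + 1) := ⟨m - l - 1, by omega⟩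
    rw [word_prefixWord, word_prefixWord, star_mul, mul_assoc, ← mul_assoc (star (_ ^ _)), hk,
      star_pow_mul_pow_add ((isCuntzFamily_s n).star_mul_self _), pow_succ', ← mul_assoc,
      ← mul_assoc, (isCuntzFamily_s n).star_mul_of_ne _ _ (Index.two_ne_one hn).symm, zero_mul,
      zero_mul]
  rcases lt_or_gt_of_ne hlm with h | h
  · exact hlt h
  · rw [← star_star (word (prefixWord hn m)), ← star_mul, hlt h, star_zero]

theorem star_elementA_mul_self (l : ℕ) : star (elementA.{u} hn l) * elementA hn l = 1 := by
  rw [elementA_eq, star_mul, mul_assoc, ← mul_assoc (star (word _)),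
    star_word_prefixWord_mul_self, one_mul,
    star_pow_mul_pow_self ((isCuntzFamily_s n).star_mul_self _)]

/-- The coefficient `2^(-l/2)`. -/
def coeff (l : ℕ+) : ℂ := (((2 : ℝ) ^ (-(l : ℝ) / 2) : ℝ) : ℂ)

theorem star_coeff (l : ℕ+) : star (coeff l) = coeff l := Complex.conj_ofReal _

theorem coeff_ne_zero (l : ℕ+) : coeff l ≠ 0 :=
  Complex.ofReal_ne_zero.mpr (Real.rpow_pos_of_pos two_pos _).ne'

theorem coeff_mul_self (l : ℕ+) : coeff l * coeff l = (((1 / 2 : ℝ) ^ (l : ℕ) : ℝ) : ℂ) := by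
  rw [coeff, ← Complex.ofReal_mul, ← Real.rpow_add two_pos, add_halves, Real.rpow_neg two_pos.le,
    Real.rpow_natCast, one_div, inv_pow]

theorem summable_norm_coeff : Summable fun l : ℕ+ => ‖coeff l‖ := by
  have h : ∀ l : ℕ+, ‖coeff l‖ = ((2 : ℝ) ^ (-(1 / 2) : ℝ)) ^ (l : ℕ) := by
    intro l
    rw [coeff, Complex.norm_real, Real.norm_of_nonneg (Real.rpow_nonneg two_pos.le _),
      ← Real.rpow_natCast, ← Real.rpow_mul two_pos.le]
    congr 1
    ring
  simp_rw [h]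
  exact (summable_geometric_of_lt_one (Real.rpow_nonneg two_pos.le _)
    (Real.rpow_lt_one_of_one_lt_of_neg one_lt_two (by norm_num))).comp_injective PNat.coe_injective

theorem hasSum_coeff_mul_self : HasSum (fun l : ℕ+ => coeff l * coeff l) 1 := by
  simp_rw [coeff_mul_self]
  rw [← Complex.ofReal_one, Complex.hasSum_ofReal, ← Equiv.pnatEquivNat.symm.hasSum_iff]
  -- Reindexed by `l = k + 1`, the terms are `1 / 2 / 2 ^ k`.
  convert hasSum_geometric_two' (1 : ℝ) using 1
  ext k
  simp [pow_succ, div_eq_mul_inv, mul_comm]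

theorem summable_elementA : Summable fun l : ℕ+ => coeff l • elementA.{u} hn l := by
  -- The norm of an isometry is `1` only in a nonzero algebra.
  obtain h | h := subsingleton_or_nontrivial (CuntzAlgebra.{u} n)
  · exact ⟨0, by convert hasSum_zero⟩
  refine Summable.of_norm_bounded summable_norm_coeff fun l => ?_
  have h1 : ‖elementA.{u} hn l‖ * ‖elementA.{u} hn l‖ = 1 := by
    rw [← CStarRing.norm_star_mul_self, star_elementA_mul_self, norm_one]
  have h2 : ‖elementA.{u} hn l‖ = 1 := by nlinarith [norm_nonneg (elementA.{u} hn l)]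
  rw [norm_smul, h2, mul_one]

section Sum

variable {hn} {a : CuntzAlgebra.{u} n}

/-- Orthogonality of the ranges isolates the `l`-th summand of the series. -/
theorem star_word_prefixWord_mul (ha : HasSum (fun l : ℕ+ => coeff l • elementA hn l) a)
    (l : ℕ+) : star (word (prefixWord hn l)) * a = coeff l • s n (Index.two hn) ^ (l : ℕ) := by
  have h := ha.mul_left (star (word (prefixWord hn l)))
  suffices heq : (fun m : ℕ+ => star (word (prefixWord hn l)) * coeff m • elementA hn m) =
      fun m => if m = l then coeff l • s.{u} n (Index.two hn) ^ (l : ℕ) else 0 from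
    h.unique (heq ▸ hasSum_ite_eq l _)
  funext m
  rw [elementA_eq, mul_smul_comm, ← mul_assoc]
  split_ifs with hml
  · rw [hml, star_word_prefixWord_mul_self, one_mul]
  · rw [star_word_prefixWord_mul_of_ne hn (Ne.symm hml), zero_mul, smul_zero]

theorem star_mul_self_eq_one (ha : HasSum (fun l : ℕ+ => coeff l • elementA hn l) a) :
    star a * a = 1 := by
  have h := (ha.star).mul_right a
  have h1 := hasSum_coeff_mul_self.smul_const (1 : CuntzAlgebra.{u} n)
  rw [one_smul] at h1
  suffices heq : (fun l : ℕ+ => star (coeff l • elementA hn l) * a) =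
      fun l => (coeff l * coeff l) • (1 : CuntzAlgebra.{u} n) from
    h.unique (heq ▸ h1)
  funext l
  rw [star_smul, star_coeff, elementA_eq, star_mul, smul_mul_assoc, mul_assoc,
    star_word_prefixWord_mul ha, mul_smul_comm,
    star_pow_mul_pow_self ((isCuntzFamily_s n).star_mul_self _), smul_smul]

/-- Up to nonzero factors, the Gram matrix of the vectors `π(s_{J_l})* π(A)Ω` is that of the vectors
`π(s₂^l)Ω`. -/
theorem conj_apply_prefixWord (ha : HasSum (fun l : ℕ+ => coeff l • elementA hn l) a)
    (ω : State (CuntzAlgebra.{u} n)) (h : ω (star a * a) = 1) (l m : ℕ+) :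
    ω.conj a h (word (prefixWord hn l) * star (word (prefixWord hn m))) =
      coeff l * coeff m *
        ω (star (s n (Index.two hn) ^ (l : ℕ)) * s n (Index.two hn) ^ (m : ℕ)) := by
  have hl := congrArg star (star_word_prefixWord_mul ha l)
  rw [star_mul, star_star, star_smul, star_coeff] at hl
  rw [State.conj_apply, ← mul_assoc, hl, mul_assoc, star_word_prefixWord_mul ha, smul_mul_assoc,
    mul_smul_comm, smul_smul]
  exact map_smul ω.1 _ _

end Sum

/-- A Cuntz state `ω` is equivalent to the state `x ↦ ω(A⋆ x A)`, which has infinite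
correlation dimension. -/
theorem exists_conj_state {ω : State (CuntzAlgebra.{u} n)} (h : ω (s n (Index.one hn)) = 1) :
    ∃ (a : CuntzAlgebra.{u} n) (ω' : State (CuntzAlgebra.{u} n)),
      HasSum (fun l : ℕ+ => coeff l • elementA hn l) a ∧
      (∀ x, ω' x = ω (star a * x * a)) ∧ kappa ω' = 1 ∧ cdim ω' = ⊤ := by
  obtain ⟨a, ha⟩ := summable_elementA.{u} hn
  have haa := star_mul_self_eq_one ha
  have h1 : ω (star a * a) = 1 := by
    rw [haa]
    exact ω.2
  refine ⟨a, ω.conj a h1, ha, fun x => rfl,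
    kappa_eq_one h (ω.conj_equivalent a (star a) h1 haa).symm,
    cdim_eq_top (fun l : ℕ+ => prefixWord hn l) (fun l => ?_) fun l m hlm => ?_⟩
  · rw [conj_apply_prefixWord ha, star_pow_mul_pow_self ((isCuntzFamily_s n).star_mul_self _),
      show ω 1 = 1 from ω.2, mul_one]
    exact mul_ne_zero (coeff_ne_zero l) (coeff_ne_zero l)
  · rw [conj_apply_prefixWord ha,
      apply_star_pow_mul_pow h (Index.two_ne_one hn) (PNat.coe_injective.ne hlm), mul_zero]

end

end Cuntz

theorem proposition3p11 (n : ℕ∞) (hn : 2 ≤ n) :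
    (∃ ω' : Cuntz.State (CuntzAlgebra.{u} n),
      Cuntz.IsEssentiallyFinitelyCorrelated ω' ∧ ¬ Cuntz.IsFinitelyCorrelated ω') ∧
    (∃! ω : Cuntz.State (CuntzAlgebra.{u} n),
      ω (CuntzAlgebra.s n (Cuntz.Index.one hn)) = 1) ∧
    ∀ ω : Cuntz.State (CuntzAlgebra.{u} n),
      ω (CuntzAlgebra.s n (Cuntz.Index.one hn)) = 1 →
      ∃ (a : CuntzAlgebra.{u} n) (ω' : Cuntz.State (CuntzAlgebra.{u} n)),
        HasSum (fun l : ℕ+ => (((2 : ℝ) ^ (-(l : ℝ) / 2) : ℝ) : ℂ) • Cuntz.elementA hn l) a ∧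
        (∀ x, ω' x = ω (star a * x * a)) ∧
        Cuntz.kappa ω' = 1 ∧ Cuntz.cdim ω' = ⊤ := by
  obtain ⟨ω, hω⟩ := Cuntz.exists_state_apply_s_eq_one.{u} (Cuntz.Index.one hn)
  obtain ⟨a, ω', -, -, hκ, hc⟩ := Cuntz.exists_conj_state hn hω
  refine ⟨⟨ω', ?_, fun hf => hf hc⟩,
    ⟨ω, hω, fun φ hφ => Cuntz.State.eq_of_apply_s_eq_one hφ hω⟩,
    fun φ hφ => Cuntz.exists_conj_state hn hφ⟩
  rw [Cuntz.IsEssentiallyFinitelyCorrelated, hκ]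
  exact ENat.one_ne_top
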